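/- **Theorem (Revolving Door Criterion).** Let $\mathcal F$ be the ring of real-rational functions $P(\mathbf z)$ with no poles on the unit circle $|\mathbf z|=1$. Such a $P$ has a unique expansion $P(\mathbf z)=\sum_{k\in\mathbb Z}p_k\mathbf z^{-k}$ on $|\mathbf z|=1$; $P$ is causal if $p_k=0$ for $k<0$, and $x=P(\mathbf z)u$ means $x(t)=\sum_k p_{t-k}u(k)$ (in mean square). The power spectral density of a wide-sense stationary real vector process $y$ is $\Phi_y(\mathbf z)=\sum_{\tau}\mathbf E[y(\tau)y(0)^T]\,\mathbf z^{-\tau}$, $|\mathbf z|=1$. For processes $x,y$, the (non-causal) Wiener filter $W_{x|y}$ is the matrix $W$ over $\mathcal F$ for which $q=W(\mathbf z)y$ minimizes $\mathbf E[(x-q)^T(x-q)]$ among all $q=P(\mathbf z)y$ with $P$ a matrix over $\mathcal F$; when $y$ is a stack of vectors that includes $y_v$, $W_{x[y_v]|y}$ denotes the block of columns of $W_{x|y}$ acting on $y_v$. Let $y=(y_i,y_j,y_k,y_s)$ be a wide-sense stationary process with (vector-valued) components $y_i,y_j,y_k,y_s$ that is the output of a linear dynamic influence model $(Q(\mathbf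 z),e)$, that is, $y=Q(\mathbf z)y+e$, where $Q$ is a block matrix over $\mathcal F$ and $e=P(\mathbf z)u$ with $P$ a block-diagonal matrix of causal elements of $\mathcal F$ and $u$ a wide-sense stationary process with $\Phi_u=\mathcal I$. Suppose that the directed graph with the edges $i\to j$, $j\to k$, $k\to i$, $s\to i$, $s\to j$, $s\to k$ (and no others, in particular no self-loops) is a graphical representation of the model: the block $Q_{wv}$ is zero whenever $v\to w$ is not one of these edges (blocks $Q_{wv}$ of edges $v\to w$ may also be zero). Suppose finally that $\Phi_y(\mathbf z)$ exists (the defining series converges) and is positive definite for all $|\mathbf z|=1$. Then the Wiener filters $W_{y_j|(y_i,y_k,y_s)}$, $W_{y_k|(y_j,y_i,y_s)}$ and $W_{y_i|(y_k,y_j,y_s)}$ exist and are unique and, writing $$W_{ji}=W_{y_j[y_i]|(y_i,y_k,y_s)},\quad W_{jk}=W_{y_j[y_k]|(y_i,y_k,y_s)},\quad W_{kj}=W_{y_k[y_j]|(y_j,y_i,y_s)},$$ $$W_{ki}=W_{y_k[y_i]|(y_j,y_i,y_s)},\quad W_{ik}=W_{y_i[y_k]|(y_k,y_j,y_s)},\quad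 W_{ij}=W_{y_i[y_j]|(y_k,y_j,y_s)},$$ the transfer matrix $Q_{ji}$ satisfies the implicit relation $$Q_{ji}=\Bigl\{\mathcal I-W_{jk}W_{kj}-W_{jk}W_{ki}\bigl(\mathcal I-W_{ij}Q_{ji}-W_{ik}W_{ki}\bigr)^{-1}W_{ik}W_{kj}\Bigr\}^{-1}W_{ji},$$ where both of the inverses exist as matrices over $\mathcal F$. -/

import Mathlib

open MeasureTheory
open scoped ComplexOrder

noncomputable section

namespace LDIM

/-! ### Transfer functions -/

/-- The ring of transfer functions: real-rational functions without poles on the unit circle. -/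
def TransferFunction : Subring (RatFunc ℝ) where
  carrier := {f | ∀ z : ℂ, ‖z‖ = 1 → Polynomial.aeval z f.denom ≠ 0}
  mul_mem' := by
    intro f g hf hg z hz h0
    have h := Polynomial.aeval_eq_zero_of_dvd_aeval_eq_zero (RatFunc.denom_mul_dvd f g) h0
    rw [map_mul] at h
    exact (mul_ne_zero (hf z hz) (hg z hz)) h
  one_mem' := by
    intro z _
    simp
  add_mem' := by
    intro f g hf hg z hz h0
    have h := Polynomial.aeval_eq_zero_of_dvd_aeval_eq_zero (RatFunc.denom_add_dvd f g) h0
    rw [map_mul] at h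
    exact (mul_ne_zero (hf z hz) (hg z hz)) h
  zero_mem' := by
    intro z _
    simp
  neg_mem' := by
    intro f hf z hz h0
    have hd : (-f).denom ∣ f.denom := by
      rw [RatFunc.denom_dvd (RatFunc.denom_ne_zero f)]
      exact ⟨-f.num, by rw [map_neg, neg_div, RatFunc.num_div_denom]⟩
    exact hf z hz (Polynomial.aeval_eq_zero_of_dvd_aeval_eq_zero hd h0)

/-- The value of a transfer function at a complex number. -/
def evalAt (P : TransferFunction) (z : ℂ) : ℂ :=
  RatFunc.eval (algebraMap ℝ ℂ) z (P : RatFunc ℝ)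

/-- `p` is the impulse response of `P`: `P(z) = ∑ₖ pₖ z⁻ᵏ` for `|z| = 1`. -/
def IsImpulseResponse (P : TransferFunction) (p : ℤ → ℝ) : Prop :=
  ∀ z : ℂ, ‖z‖ = 1 → HasSum (fun k : ℤ => (p k : ℂ) * z ^ (-k)) (evalAt P z)

/-- Causal transfer functions: the impulse response vanishes at negative times. -/
def IsCausal (P : TransferFunction) : Prop :=
  ∃ p : ℤ → ℝ, IsImpulseResponse P p ∧ ∀ k < 0, p k = 0

/-! ### Second-order vector processes in discrete time -/

/-- A real vector process indexed by `ℤ`, with square integrable coordinates. -/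
abbrev VecProcess {Ω : Type*} [MeasurableSpace Ω] (μ : Measure Ω) (ι : Type*) :=
  ℤ → ι → Lp ℝ 2 μ

section Processes

variable {Ω : Type*} [MeasurableSpace Ω] {μ : Measure Ω} {ι κ : Type*}

/-- The correlation matrix `R(τ) = E[y(τ) y(0)ᵀ]`. -/
def correlation (y : VecProcess μ ι) (τ : ℤ) : Matrix ι ι ℝ :=
  Matrix.of fun a b => inner ℝ (y τ a) (y 0 b)

/-- Wide-sense stationarity: the mean and the correlations are invariant under time shifts. -/
structure IsWSS (y : VecProcess μ ι) : Prop where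
  mean_eq : ∀ t a, ∫ ω, y t a ω ∂μ = ∫ ω, y 0 a ω ∂μ
  inner_eq : ∀ t τ a b, inner ℝ (y (t + τ) a) (y t b) = correlation y τ a b

/-- `Φ` is the power spectral density of `y` on the unit circle: `Φ(z) = ∑_τ R(τ) z^{-τ}`. -/
def HasPSD (y : VecProcess μ ι) (Φ : ℂ → Matrix ι ι ℂ) : Prop :=
  ∀ z : ℂ, ‖z‖ = 1 → ∀ a b,
    HasSum (fun τ : ℤ => (correlation y τ a b : ℂ) * z ^ (-τ)) (Φ z a b)

/-- `x = P(z) u`: the process `x` is the convolution of `u` with the impulse response of `P`,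
`x(t) = ∑ₖ p(t - k) u(k)`, the series converging in mean square. -/
def IsFiltered [Fintype κ] (P : Matrix ι κ TransferFunction) (u : VecProcess μ κ)
    (x : VecProcess μ ι) : Prop :=
  ∃ p : ι → κ → ℤ → ℝ, (∀ a b, IsImpulseResponse (P a b) (p a b)) ∧
    ∀ t a, HasSum (fun k : ℤ => ∑ b, p a b (t - k) • u k b) (x t a)

/-- `W` is a (non-causal) Wiener filter estimating `x` from `y`: the process `W(z) y` minimizes
the mean square error `E[(x - q)ᵀ (x - q)]` among all `q = P(z) y` with `P` a matrix of transfer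
functions, that is, over the transfer function span of `y`. -/
def IsWienerFilter [Fintype ι] [Fintype κ] (x : VecProcess μ ι) (y : VecProcess μ κ)
    (W : Matrix ι κ TransferFunction) : Prop :=
  ∃ xhat : VecProcess μ ι, IsFiltered W y xhat ∧
    ∀ (P : Matrix ι κ TransferFunction) (q : VecProcess μ ι), IsFiltered P y q →
      ∀ t, ∑ a, ‖x t a - xhat t a‖ ^ 2 ≤ ∑ a, ‖x t a - q t a‖ ^ 2

end Processes

/-! ### Block structure: node `v` carries a vector process of dimension `d v` -/

section Blocks

variable {V : Type*}

/-- The scalar coordinates of the stacked vector of all nodes. -/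
abbrev Coord (d : V → ℕ) := Σ v : V, Fin (d v)

/-- The scalar coordinates of the stacked vector of the nodes in `S`. -/
abbrev SubCoord (d : V → ℕ) (S : Finset V) := Σ v : {v : V // v ∈ S}, Fin (d v)

variable {d : V → ℕ}

/-- The block of `Q` in block row `w` and block column `v`, mapping node `v` to node `w`. -/
def block (Q : Matrix (Coord d) (Coord d) TransferFunction) (w v : V) :
    Matrix (Fin (d w)) (Fin (d v)) TransferFunction :=
  Matrix.of fun a b => Q ⟨w, a⟩ ⟨v, b⟩

/-- The component, acting on node `v`, of a filter whose input is the vector of nodes in `S`. -/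
def component {ι : Type*} {S : Finset V} (W : Matrix ι (SubCoord d S) TransferFunction)
    (v : V) (hv : v ∈ S) : Matrix ι (Fin (d v)) TransferFunction :=
  Matrix.of fun a b => W a ⟨⟨v, hv⟩, b⟩

variable {Ω : Type*} [MeasurableSpace Ω] {μ : Measure Ω}

/-- The vector process at node `v`. -/
def nodeProcess (y : VecProcess μ (Coord d)) (v : V) : VecProcess μ (Fin (d v)) :=
  fun t a => y t ⟨v, a⟩

/-- The vector process obtained by stacking the nodes in `S`. -/
def subProcess (y : VecProcess μ (Coord d)) (S : Finset V) : VecProcess μ (SubCoord d S) :=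
  fun t a => y t ⟨a.1, a.2⟩

/-- `(Q, e)` is a linear dynamic influence model with output `y`: `y = Q(z) y + e`, where
`e = P(z) u` with `P` causal and block diagonal and `u` wide-sense stationary with `Φ_u = I`. -/
structure IsLDIM [Fintype V] [DecidableEq V] (Q : Matrix (Coord d) (Coord d) TransferFunction)
    (e y : VecProcess μ (Coord d)) : Prop where
  wss : IsWSS y
  input : ∃ (m : V → ℕ) (u : VecProcess μ (Coord m))
    (P : Matrix (Coord d) (Coord m) TransferFunction),
      IsWSS u ∧ HasPSD u (fun _ => 1) ∧
      (∀ a b, IsCausal (P a b)) ∧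
      (∀ (a : Coord d) (b : Coord m), a.1 ≠ b.1 → P a b = 0) ∧
      IsFiltered P u e
  dynamics : IsFiltered Q y (y - e)

/-- `G` is a graphical representation of `Q`: a missing edge `v → w` forces `Q_{wv} = 0`. -/
def IsGraphicalRepresentation (G : Digraph V)
    (Q : Matrix (Coord d) (Coord d) TransferFunction) : Prop :=
  ∀ v w, ¬ G.Adj v w → block Q w v = 0

end Blocks

/-! ### The four-node loop with a common external process -/

/-- The four nodes `y_i, y_j, y_k, y_s`. -/
inductive Node
  | i | j | k | s
  deriving DecidableEq

instance : Fintype Node :=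
  ⟨{.i, .j, .k, .s}, by intro v; cases v <;> decide⟩

/-- The loop `i → j → k → i` together with the edges `s → i`, `s → j`, `s → k`. -/
def loopGraph : Digraph Node where
  Adj v w := (v, w) ∈ ({(.i, .j), (.j, .k), (.k, .i), (.s, .i), (.s, .j), (.s, .k)} :
    Set (Node × Node))

end LDIM

end

noncomputable section

namespace LDIM

/-! ### Transfer functions as functions on the unit circle -/

/-! Let `K = Φ⁻¹` on the unit circle. Orthogonality of the estimation error turns the Wiener
property of a filter `W` for node `v` from all other nodes into `Φ_{v,rest} = W Φ_{rest,rest}`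
(`isWienerFilter_iff`), and block inversion turns this into `K_vv W = -K_{v,rest}`
(`eq_mul_iff_of_mul_eq_one`). As `K_vv` is positive definite, the filter exists, is unique, and has
components `-K_vv⁻¹ K_vw`.

The model gives `K = (1 - Q)ᴴ S (1 - Q)`, where `S` is the inverse of the block diagonal noise
spectrum (`IsLDIM.exists_inverse_spectrum`). In the column of a loop node `v`, the matrix `1 - Q`
has nonzero blocks only at `v` and its successor `w`. Hence `K_vv = S_v + Q_wvᴴ S_w Q_wv` and `K_wv
= -S_w Q_wv`, free of any trace of `s`.

What remains is noncommutative algebra (`revolving_door_algebra`). The inner inverse is a Woodbury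
inverse, and its term corrects `W_kj` to `Q_kj`. So the outer matrix is `B = 1 - W_jk Q_kj`, with
`K_jj B = S_j` and `K_jj W_ji = S_j Q_ji`; eliminating `K_jj` gives the formula.

Everything stays over the ring of transfer functions because that ring is closed under conjugation
on the circle and a matrix over it is a unit as soon as it is invertible at each point of the
circle. -/

/-- Evaluation at a point of the unit circle, as a ring homomorphism. -/
def evalHom (z : ℂ) (hz : ‖z‖ = 1) : TransferFunction →+* ℂ where
  toFun P := evalAt P z
  map_one' := by simp [evalAt]
  map_zero' := by simp [evalAt]
  map_mul' P R := RatFunc.eval_mul (algebraMap ℝ ℂ) z (P.2 z hz) (R.2 z hz)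
  map_add' P R := RatFunc.eval_add (algebraMap ℝ ℂ) z (P.2 z hz) (R.2 z hz)

@[simp]
theorem evalHom_apply (z : ℂ) (hz : ‖z‖ = 1) (P : TransferFunction) :
    evalHom z hz P = evalAt P z := rfl

theorem evalAt_eq_div (P : TransferFunction) (z : ℂ) :
    evalAt P z =
      Polynomial.aeval z (P : RatFunc ℝ).num / Polynomial.aeval z (P : RatFunc ℝ).denom :=
  rfl

theorem infinite_unitCircle : {z : ℂ | ‖z‖ = 1}.Infinite := by
  refine Set.infinite_of_injOn_mapsTo (f := fun x : ℝ => (Circle.exp x : ℂ))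
    (s := Set.Ioc (-Real.pi) Real.pi) ?_ (fun x _ => Circle.norm_coe _)
    (Set.Ioc_infinite (by linarith [Real.pi_pos]))
  intro x hx y hy hxy
  have h := congrArg Complex.arg hxy
  simpa only [Circle.arg_exp hx.1 hx.2, Circle.arg_exp hy.1 hy.2] using h

theorem eq_zero_of_aeval_unitCircle {p : Polynomial ℝ}
    (h : ∀ z : ℂ, ‖z‖ = 1 → Polynomial.aeval z p = 0) : p = 0 := by
  have hp : p.map (algebraMap ℝ ℂ) = 0 := by
    refine Polynomial.eq_zero_of_infinite_isRoot _ (infinite_unitCircle.mono ?_)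
    intro z hz
    simpa [Polynomial.IsRoot, Polynomial.eval_map_algebraMap] using h z hz
  exact (Polynomial.map_eq_zero_iff (algebraMap ℝ ℂ).injective).1 hp

/-- A transfer function is determined by its values on the unit circle. -/
theorem ext_unitCircle {f g : TransferFunction}
    (h : ∀ z : ℂ, ‖z‖ = 1 → evalAt f z = evalAt g z) : f = g := by
  rw [← sub_eq_zero]
  have h0 : ∀ z : ℂ, ‖z‖ = 1 → evalAt (f - g) z = 0 := fun z hz => by
    rw [← evalHom_apply z hz, map_sub, evalHom_apply, evalHom_apply, h z hz, sub_self]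
  have hn : ((f - g : TransferFunction) : RatFunc ℝ).num = 0 := by
    refine eq_zero_of_aeval_unitCircle fun z hz => ?_
    have := h0 z hz
    rw [evalAt_eq_div, div_eq_zero_iff] at this
    exact this.resolve_right ((f - g).2 z hz)
  exact Subtype.ext (RatFunc.num_eq_zero_iff.1 hn)

/-- A quotient of polynomials whose denominator has no zeros on the unit circle. -/
theorem exists_evalAt_eq_div (p q : Polynomial ℝ)
    (hq : ∀ z : ℂ, ‖z‖ = 1 → Polynomial.aeval z q ≠ 0) :
    ∃ f : TransferFunction,
      ∀ z : ℂ, ‖z‖ = 1 → evalAt f z = Polynomial.aeval z p / Polynomial.aeval z q := by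
  have hq0 : q ≠ 0 := by
    rintro rfl
    exact hq 1 (by simp) (by simp)
  set f : RatFunc ℝ := algebraMap _ (RatFunc ℝ) p / algebraMap _ _ q with hf
  have hd : ∀ z : ℂ, ‖z‖ = 1 → Polynomial.aeval z f.denom ≠ 0 := fun z hz h0 =>
    hq z hz (Polynomial.aeval_eq_zero_of_dvd_aeval_eq_zero
      ((RatFunc.denom_dvd hq0).2 ⟨p, hf⟩) h0)
  refine ⟨⟨f, hd⟩, fun z hz => ?_⟩
  rw [evalAt_eq_div, div_eq_div_iff (hd z hz) (hq z hz), ← map_mul, ← map_mul]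
  congr 1
  exact (RatFunc.num_mul_eq_mul_denom_iff hq0).2 hf

/-- The inverse swaps numerator and denominator, which is allowed because the numerator has no zeros
on the circle. -/
theorem isUnit_of_evalAt_ne_zero {f : TransferFunction}
    (h : ∀ z : ℂ, ‖z‖ = 1 → evalAt f z ≠ 0) : IsUnit f := by
  have hn : ∀ z : ℂ, ‖z‖ = 1 → Polynomial.aeval z (f : RatFunc ℝ).num ≠ 0 := by
    intro z hz h0
    apply h z hz
    rw [evalAt_eq_div, h0, zero_div]
  obtain ⟨g, hg⟩ := exists_evalAt_eq_div (f : RatFunc ℝ).denom (f : RatFunc ℝ).num hn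
  refine IsUnit.of_mul_eq_one g (ext_unitCircle fun z hz => ?_)
  rw [← evalHom_apply z hz, ← evalHom_apply z hz, map_mul, map_one, evalHom_apply, evalHom_apply,
    hg z hz, evalAt_eq_div]
  have h1 := hn z hz
  have h2 : Polynomial.aeval z (f : RatFunc ℝ).denom ≠ 0 := f.2 z hz
  field_simp

/-- On the circle `conj z = z⁻¹`, and the coefficients are real, so conjugating the value amounts to
reversing the coefficients up to a power of `z`. -/
theorem aeval_reverse_unitCircle (p : Polynomial ℝ) {z : ℂ} (hz : ‖z‖ = 1) :
    Polynomial.aeval z p.reverse = z ^ p.natDegree * starRingEnd ℂ (Polynomial.aeval z p) := by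
  have hz0 : z ≠ 0 := by rintro rfl; simp at hz
  have hc : starRingEnd ℂ z = z⁻¹ := by
    rw [Complex.inv_def, Complex.normSq_eq_norm_sq, hz]; simp
  have : Invertible (starRingEnd ℂ z) := invertibleOfNonzero (by rw [hc]; exact inv_ne_zero hz0)
  have h1 := Polynomial.eval₂_reverse_mul_pow (algebraMap ℝ ℂ) (starRingEnd ℂ z) p
  have h2 : ⅟(starRingEnd ℂ z) = z := by rw [invOf_eq_inv, hc, inv_inv]
  rw [h2] at h1
  have h3 : starRingEnd ℂ (Polynomial.aeval z p) = Polynomial.aeval (starRingEnd ℂ z) p :=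
    (Polynomial.aeval_conj p z).symm
  rw [h3, Polynomial.aeval_def, Polynomial.aeval_def, ← h1, hc, mul_left_comm, ← mul_pow,
    mul_inv_cancel₀ hz0, one_pow, mul_one]

/-- Real-rational functions without poles on the unit circle are closed under the
para-conjugation `f(z) ↦ f(1/z)`, which is complex conjugation on the unit circle. -/
theorem exists_evalAt_eq_conj (f : TransferFunction) :
    ∃ g : TransferFunction, ∀ z : ℂ, ‖z‖ = 1 → evalAt g z = starRingEnd ℂ (evalAt f z) := by
  set p := (f : RatFunc ℝ).num
  set q := (f : RatFunc ℝ).denom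
  have hX : ∀ z : ℂ, ‖z‖ = 1 → z ≠ 0 := by rintro z hz rfl; simp at hz
  have hq : ∀ z : ℂ, ‖z‖ = 1 → starRingEnd ℂ (Polynomial.aeval z q) ≠ 0 := fun z hz =>
    (map_ne_zero _).2 (f.2 z hz)
  -- The crossed powers of `X` cancel the factors `z ^ natDegree` produced by the two reversals.
  obtain ⟨g, hg⟩ := exists_evalAt_eq_div (p.reverse * Polynomial.X ^ q.natDegree)
    (q.reverse * Polynomial.X ^ p.natDegree) (by
      intro z hz
      have := hX z hz
      have := hq z hz
      rw [map_mul, aeval_reverse_unitCircle q hz, map_pow, Polynomial.aeval_X]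
      positivity)
  refine ⟨g, fun z hz => ?_⟩
  have h1 := hX z hz
  have h2 := hq z hz
  rw [hg z hz, evalAt_eq_div, map_mul, map_mul, aeval_reverse_unitCircle q hz,
    aeval_reverse_unitCircle p hz, map_pow, map_pow, Polynomial.aeval_X, map_div₀]
  change _ = starRingEnd ℂ (Polynomial.aeval z p) / starRingEnd ℂ (Polynomial.aeval z q)
  field_simp

/-! ### Matrices of transfer functions -/

section Matrices

variable {ι κ l : Type*}

/-- The value of a matrix of transfer functions at a complex number. -/
def evalMat (P : Matrix ι κ TransferFunction) (z : ℂ) : Matrix ι κ ℂ :=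
  P.map fun f => evalAt f z

@[simp]
theorem evalMat_apply (P : Matrix ι κ TransferFunction) (z : ℂ) (a : ι) (b : κ) :
    evalMat P z a b = evalAt (P a b) z := rfl

theorem ext_evalMat {P R : Matrix ι κ TransferFunction}
    (h : ∀ z : ℂ, ‖z‖ = 1 → evalMat P z = evalMat R z) : P = R := by
  ext1 a b
  exact ext_unitCircle fun z hz => congrFun (congrFun (h z hz) a) b

theorem evalMat_mul [Fintype κ] (P : Matrix ι κ TransferFunction) (R : Matrix κ l TransferFunction)
    {z : ℂ} (hz : ‖z‖ = 1) : evalMat (P * R) z = evalMat P z * evalMat R z :=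
  Matrix.map_mul (f := evalHom z hz)

theorem evalMat_sub (P R : Matrix ι κ TransferFunction) {z : ℂ} (hz : ‖z‖ = 1) :
    evalMat (P - R) z = evalMat P z - evalMat R z :=
  Matrix.map_sub (evalHom z hz) (map_sub _) P R

theorem evalMat_one [DecidableEq ι] {z : ℂ} (hz : ‖z‖ = 1) :
    evalMat (1 : Matrix ι ι TransferFunction) z = 1 :=
  Matrix.map_one (evalHom z hz) (map_zero _) (map_one _)

theorem isUnit_of_isUnit_evalMat [Fintype ι] [DecidableEq ι] {P : Matrix ι ι TransferFunction}
    (h : ∀ z : ℂ, ‖z‖ = 1 → IsUnit (evalMat P z)) : IsUnit P := by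
  rw [Matrix.isUnit_iff_isUnit_det]
  refine isUnit_of_evalAt_ne_zero fun z hz => ?_
  have := (Matrix.isUnit_iff_isUnit_det _).1 (h z hz)
  rw [← evalHom_apply z hz, RingHom.map_det]
  exact this.ne_zero

theorem exists_evalMat_eq_conjTranspose (P : Matrix ι κ TransferFunction) :
    ∃ R : Matrix κ ι TransferFunction,
      ∀ z : ℂ, ‖z‖ = 1 → evalMat R z = (evalMat P z).conjTranspose := by
  choose g hg using exists_evalAt_eq_conj
  exact ⟨Matrix.of fun b a => g (P a b), fun z hz => by ext b a; exact hg _ z hz⟩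

end Matrices

/-! ### Absolutely convergent Laurent series on the unit circle -/

theorem hasSum_of_forall_eq {α M : Type*} [AddCommMonoid M] [TopologicalSpace M]
    {f g : α → M} {a b : M} (h : HasSum f a)
    (hfg : ∀ k, g k = f k) (hab : b = a) : HasSum g b := by
  rwa [hab, funext hfg]

/-- The shear `(n, m) ↦ (n - m, m)` of `ℤ × ℤ`. -/
def shear : ℤ × ℤ ≃ ℤ × ℤ where
  toFun x := (x.1 - x.2, x.2)
  invFun x := (x.1 + x.2, x.2)
  left_inv x := by simp
  right_inv x := by simp

/-- The Cauchy product of two absolutely convergent series indexed by `ℤ`. -/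
theorem hasSum_cauchyProduct {f g : ℤ → ℂ} {a b : ℂ} (hf : HasSum f a) (hg : HasSum g b) :
    HasSum (fun n => ∑' m, f (n - m) * g m) (a * b) := by
  have h1 : HasSum (fun x : ℤ × ℤ => f x.1 * g x.2) (a * b) :=
    hf.mul hg (summable_mul_of_summable_norm hf.summable.norm hg.summable.norm)
  have h2 : HasSum (fun x : ℤ × ℤ => f (x.1 - x.2) * g x.2) (a * b) := shear.hasSum_iff.2 h1
  have h3 : ∀ n, Summable fun m => f (n - m) * g m := fun n => h2.summable.prod_factor n
  exact h2.prod_fiberwise fun n => (h3 n).hasSum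

/-- `g` is the sum of the Laurent series `∑ₖ cₖ z⁻ᵏ` on the unit circle. -/
def HasLaurent (c : ℤ → ℂ) (g : ℂ → ℂ) : Prop :=
  ∀ z : ℂ, ‖z‖ = 1 → HasSum (fun k : ℤ => c k * z ^ (-k)) (g z)

namespace HasLaurent

variable {c c' : ℤ → ℂ} {g g' : ℂ → ℂ}

theorem summable_norm (h : HasLaurent c g) : Summable fun k => ‖c k‖ := by
  have := (h 1 (by simp)).summable.norm
  simpa using this

theorem congr (h : HasLaurent c g) (hg : ∀ z : ℂ, ‖z‖ = 1 → g z = g' z) : HasLaurent c g' :=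
  fun z hz => hg z hz ▸ h z hz

theorem add (h : HasLaurent c g) (h' : HasLaurent c' g') :
    HasLaurent (fun k => c k + c' k) (fun z => g z + g' z) := fun z hz => by
  simpa only [add_mul] using (h z hz).add (h' z hz)

theorem sub (h : HasLaurent c g) (h' : HasLaurent c' g') :
    HasLaurent (fun k => c k - c' k) (fun z => g z - g' z) := fun z hz => by
  simpa only [sub_mul] using (h z hz).sub (h' z hz)

theorem sum {α : Type*} {s : Finset α} {c : α → ℤ → ℂ} {g : α → ℂ → ℂ}
    (h : ∀ a ∈ s, HasLaurent (c a) (g a)) :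
    HasLaurent (fun k => ∑ a ∈ s, c a k) (fun z => ∑ a ∈ s, g a z) := fun z hz => by
  simpa only [Finset.sum_mul] using hasSum_sum fun a ha => h a ha z hz

theorem const_mul (h : HasLaurent c g) (r : ℂ) :
    HasLaurent (fun k => r * c k) (fun z => r * g z) := fun z hz => by
  simpa only [mul_assoc] using (h z hz).mul_left r

/-- A monomial is its own Laurent series. -/
theorem monomial (n : ℤ) (r : ℂ) : HasLaurent (Pi.single n r) (fun z => r * z ^ (-n)) := by
  intro z _
  convert hasSum_single (f := fun k : ℤ => (Pi.single n r : ℤ → ℂ) k * z ^ (-k)) n ?_ using 1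
  · simp
  · intro k hk
    simp [Pi.single_eq_of_ne hk]

/-- The complex conjugate on the unit circle has the time-reversed conjugate coefficients. -/
theorem conj (h : HasLaurent c g) :
    HasLaurent (fun k => starRingEnd ℂ (c (-k))) (fun z => starRingEnd ℂ (g z)) := by
  intro z hz
  have hc : starRingEnd ℂ z = z⁻¹ := by
    rw [Complex.inv_def, Complex.normSq_eq_norm_sq, hz]; simp
  have h1 := ((Equiv.neg ℤ).hasSum_iff.2 (h z hz)).map (starRingEnd ℂ) Complex.continuous_conj
  convert h1 using 2
  simp [hc]

theorem summable_conv (h : HasLaurent c g) (h' : HasLaurent c' g') (n : ℤ) :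
    Summable fun m => c (n - m) * c' m := by
  have h1 : Summable fun x : ℤ × ℤ => c x.1 * c' x.2 :=
    summable_mul_of_summable_norm h.summable_norm h'.summable_norm
  have hi : Function.Injective fun m : ℤ => (n - m, m) := fun a b hab => (Prod.ext_iff.1 hab).2
  exact (h1.comp_injective hi :)

/-- Convolution of coefficients is multiplication of sums. -/
theorem conv (h : HasLaurent c g) (h' : HasLaurent c' g') :
    HasLaurent (fun n => ∑' m, c (n - m) * c' m) (fun z => g z * g' z) := by
  intro z hz
  have hz0 : z ≠ 0 := by rintro rfl; simp at hz
  have h2 := hasSum_cauchyProduct (h z hz) (h' z hz)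
  refine hasSum_of_forall_eq h2 (fun n => ?_) rfl
  rw [← tsum_mul_right]
  refine tsum_congr fun m => ?_
  have : z ^ (-n) = z ^ (-(n - m)) * z ^ (-m) := by
    rw [← zpow_add₀ hz0]; congr 1; ring
  rw [this]
  ring

/-- The coefficients of an absolutely convergent Laurent series are unique. -/
theorem eq_zero (h : HasLaurent c fun _ => 0) : c = 0 := by
  -- The series converges uniformly, so it can be summed in the continuous functions on the circle
  -- and then in `L²`. There, pairing with one Fourier mode isolates one coefficient.
  let F : ℤ → C(AddCircle (1 : ℝ), ℂ) := fun k => c k • fourier (-k)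
  have hF : Summable F := by
    refine Summable.of_norm ?_
    simpa only [F, norm_smul, fourier_norm, mul_one] using h.summable_norm
  have h0 : HasSum F 0 := by
    convert hF.hasSum
    ext x
    have h1 := hF.hasSum.mapL (ContinuousMap.evalCLM ℂ x)
    have h2 := h (AddCircle.toCircle x) (Circle.norm_coe _)
    refine (h1.unique ?_).symm
    refine hasSum_of_forall_eq h2 (fun k => ?_) rfl
    simp [F, fourier_apply, AddCircle.toCircle_zsmul, AddCircle.toCircle_neg]
  funext m
  have h1 := (h0.mapL (ContinuousMap.toLp 2 AddCircle.haarAddCircle ℂ)).mapL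
    (innerSL ℂ (fourierLp (T := 1) 2 (-m)))
  rw [map_zero, map_zero] at h1
  have horth := orthonormal_iff_ite.1 (orthonormal_fourier (T := 1))
  have h2 := hasSum_single (f := fun k => innerSL ℂ (fourierLp (T := 1) 2 (-m))
    ((ContinuousMap.toLp 2 AddCircle.haarAddCircle ℂ) (F k))) m (fun k hk => by
      have := horth (-m) (-k)
      rw [if_neg (by simpa [eq_comm] using hk)] at this
      simp only [F, map_smul, innerSL_apply_apply, this, smul_zero])
  have h3 := h2.unique h1
  have := horth (-m) (-m)
  simp only [F, map_smul, innerSL_apply_apply, this, if_true, smul_eq_mul, mul_one] at h3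
  exact h3

end HasLaurent

/-! ### Impulse responses exist -/

/-- Geometric series: in `a / z` for a pole inside the circle, in `z / a` for a pole outside. -/
theorem exists_hasLaurent_inv_sub (a : ℂ) (ha : ‖a‖ ≠ 1) :
    ∃ c, HasLaurent c fun z => (z - a)⁻¹ := by
  rcases lt_or_gt_of_ne ha with ha | ha
  · have hinj : Function.Injective fun n : ℕ => (n + 1 : ℤ) := fun m n hmn => by
      simpa using hmn
    refine ⟨Function.extend (fun n : ℕ => (n + 1 : ℤ)) (fun n => a ^ n) 0, fun z hz => ?_⟩
    have hz0 : z ≠ 0 := by rintro rfl; simp at hz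
    refine (hinj.hasSum_iff fun k hk => ?_).1 ?_
    · rw [Function.extend_apply' _ _ _ (by simpa using hk)]; simp
    · have h1 := (hasSum_geometric_of_norm_lt_one (ξ := a / z) (by simpa [hz] using ha)).mul_left z⁻¹
      refine hasSum_of_forall_eq h1 (fun n => ?_) ?_
      · simp only [Function.comp, hinj.extend_apply]
        rw [zpow_neg, zpow_add₀ hz0, zpow_one, zpow_natCast, div_pow]
        field_simp
      · rw [← mul_inv, mul_sub, mul_div_cancel₀ _ hz0, mul_one]
  · have hinj : Function.Injective fun n : ℕ => (-n : ℤ) := fun m n hmn => by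
      simpa using hmn
    have ha0 : a ≠ 0 := by rintro rfl; simp at ha; linarith
    refine ⟨Function.extend (fun n : ℕ => (-n : ℤ)) (fun n => -(a⁻¹ ^ (n + 1))) 0, fun z hz => ?_⟩
    have hz0 : z ≠ 0 := by rintro rfl; simp at hz
    refine (hinj.hasSum_iff fun k hk => ?_).1 ?_
    · rw [Function.extend_apply' _ _ _ (by simpa using hk)]; simp
    · have h1 := (hasSum_geometric_of_norm_lt_one (ξ := z / a) (by
        rw [norm_div, hz]; exact (div_lt_one (by linarith)).2 ha)).mul_left (-a⁻¹)
      refine hasSum_of_forall_eq h1 (fun n => ?_) ?_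
      · simp only [Function.comp, hinj.extend_apply]
        rw [neg_neg, zpow_natCast, div_pow, pow_succ, inv_pow]
        field_simp
      · rw [← inv_neg, ← mul_inv, mul_sub, neg_mul a (z / a), mul_div_cancel₀ _ ha0]
        ring

theorem exists_hasLaurent_inv_prod (s : Multiset ℂ) (hs : ∀ a ∈ s, ‖a‖ ≠ 1) :
    ∃ c, HasLaurent c fun z => (s.map fun a => z - a).prod⁻¹ := by
  induction s using Multiset.induction_on with
  | empty => exact ⟨_, (HasLaurent.monomial 0 1).congr fun z _ => by simp⟩
  | cons a s ih =>
    obtain ⟨c, hc⟩ := exists_hasLaurent_inv_sub a (hs a (by simp))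
    obtain ⟨c', hc'⟩ := ih fun b hb => hs b (by simp [hb])
    exact ⟨_, (hc.conv hc').congr fun z _ => by simp [mul_comm]⟩

theorem exists_hasLaurent_aeval (p : Polynomial ℝ) :
    ∃ c, HasLaurent c fun z => Polynomial.aeval z p := by
  induction p using Polynomial.induction_on' with
  | add p q hp hq =>
    obtain ⟨c, hc⟩ := hp
    obtain ⟨c', hc'⟩ := hq
    exact ⟨_, (hc.add hc').congr fun z _ => by simp⟩
  | monomial n r =>
    exact ⟨_, (HasLaurent.monomial (-n) r).congr fun z _ => by
      simp [Polynomial.aeval_monomial]⟩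

/-- Over `ℂ` the polynomial splits into linear factors; the series of their inverses are convolved.
-/
theorem exists_hasLaurent_inv_aeval (q : Polynomial ℝ)
    (hq : ∀ z : ℂ, ‖z‖ = 1 → Polynomial.aeval z q ≠ 0) :
    ∃ c, HasLaurent c fun z => (Polynomial.aeval z q)⁻¹ := by
  set r := q.map (algebraMap ℝ ℂ) with hr
  have hev : ∀ z : ℂ, Polynomial.aeval z q = r.eval z := fun z => by
    rw [hr, Polynomial.eval_map_algebraMap]
  obtain ⟨c, hc⟩ := exists_hasLaurent_inv_prod r.roots fun a ha h1 =>
    hq a h1 (by rw [hev]; exact Polynomial.isRoot_of_mem_roots ha)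
  refine ⟨_, (hc.const_mul r.leadingCoeff⁻¹).congr fun z _ => ?_⟩
  have h2 := congrArg (Polynomial.eval z) (IsAlgClosed.splits r).eq_prod_roots
  rw [Polynomial.eval_mul, Polynomial.eval_C, Polynomial.eval_multiset_prod, Multiset.map_map] at h2
  rw [hev, h2, mul_inv]
  simp

theorem evalAt_conj (P : TransferFunction) (z : ℂ) :
    evalAt P (starRingEnd ℂ z) = starRingEnd ℂ (evalAt P z) := by
  rw [evalAt_eq_div, evalAt_eq_div, map_div₀, Polynomial.aeval_conj, Polynomial.aeval_conj]

/-- Every transfer function has an impulse response. -/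
theorem exists_isImpulseResponse (P : TransferFunction) : ∃ p, IsImpulseResponse P p := by
  obtain ⟨c, hc⟩ := exists_hasLaurent_aeval (P : RatFunc ℝ).num
  obtain ⟨c', hc'⟩ := exists_hasLaurent_inv_aeval (P : RatFunc ℝ).denom P.2
  obtain ⟨a, ha⟩ : ∃ a, HasLaurent a (evalAt P) :=
    ⟨_, (hc.conv hc').congr fun z _ => by rw [evalAt_eq_div, div_eq_mul_inv]⟩
  -- Since `P` has real coefficients, conjugating its series at `conj z` gives another series for
  -- `P(z)`; averaging the two leaves the real parts.
  refine ⟨fun k => (a k).re, fun z hz => ?_⟩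
  have h1 := ha z hz
  have h2 := (ha (starRingEnd ℂ z) (by simpa using hz)).map (starRingEnd ℂ) Complex.continuous_conj
  rw [evalAt_conj, Complex.conj_conj] at h2
  have h3 := (h1.add h2).mul_left (1 / 2)
  refine hasSum_of_forall_eq h3 (fun k => ?_) ?_
  · simp only [Function.comp, map_mul, map_zpow₀, Complex.conj_conj]
    rw [← add_mul, Complex.add_conj]
    push_cast
    ring
  · ring

/-! ### Cross spectra -/

section Spectra

variable {Ω : Type*} [MeasurableSpace Ω] {μ : Measure Ω} {ι κ l : Type*}

/-- `x` and `y` are jointly stationary, with absolutely summable cross-correlation, and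
`G(z) = ∑_τ E[x(τ) y(0)ᵀ] z^{-τ}` on the unit circle. -/
def HasCrossSpectrum (x : VecProcess μ ι) (y : VecProcess μ κ) (G : ℂ → Matrix ι κ ℂ) : Prop :=
  ∃ R : ι → κ → ℤ → ℝ, (∀ t τ a b, inner ℝ (x (t + τ) a) (y t b) = R a b τ) ∧
    ∀ a b, HasLaurent (fun τ => (R a b τ : ℂ)) (fun z => G z a b)

theorem IsWSS.hasCrossSpectrum {y : VecProcess μ ι} {Φ : ℂ → Matrix ι ι ℂ} (h : IsWSS y)
    (hΦ : HasPSD y Φ) : HasCrossSpectrum y y Φ :=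
  ⟨fun a b τ => correlation y τ a b, h.inner_eq, fun a b z hz => hΦ z hz a b⟩

namespace HasCrossSpectrum

variable {x x' : VecProcess μ ι} {y : VecProcess μ κ} {G G' : ℂ → Matrix ι κ ℂ}

theorem unique (h : HasCrossSpectrum x y G) (h' : HasCrossSpectrum x y G') {z : ℂ}
    (hz : ‖z‖ = 1) : G z = G' z := by
  obtain ⟨R, hR, hG⟩ := h
  obtain ⟨R', hR', hG'⟩ := h'
  have : R = R' := by
    funext a b τ
    rw [← hR 0, ← hR' 0]
  subst this
  ext a b
  exact (hG a b z hz).unique (hG' a b z hz)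

theorem symm (h : HasCrossSpectrum x y G) :
    HasCrossSpectrum y x fun z => (G z).conjTranspose := by
  obtain ⟨R, hR, hG⟩ := h
  refine ⟨fun b a τ => R a b (-τ), fun t τ b a => ?_, fun b a => ?_⟩
  · beta_reduce
    rw [← hR (t + τ) (-τ), real_inner_comm, add_neg_cancel_right]
  · have := (hG a b).conj
    simp only [Complex.conj_ofReal] at this
    exact this

theorem sub_left (h : HasCrossSpectrum x y G) (h' : HasCrossSpectrum x' y G') :
    HasCrossSpectrum (x - x') y fun z => G z - G' z := by
  obtain ⟨R, hR, hG⟩ := h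
  obtain ⟨R', hR', hG'⟩ := h'
  refine ⟨fun a b τ => R a b τ - R' a b τ, fun t τ a b => ?_, fun a b => ?_⟩
  · rw [Pi.sub_apply, Pi.sub_apply, inner_sub_left, hR, hR']
  · have := (hG a b).sub (hG' a b)
    simpa only [Matrix.sub_apply, Complex.ofReal_sub] using this

theorem submatrix {ι' κ' : Type*} (h : HasCrossSpectrum x y G) (f : ι' → ι) (g : κ' → κ) :
    HasCrossSpectrum (fun t a => x t (f a)) (fun t b => y t (g b))
      fun z => (G z).submatrix f g := by
  obtain ⟨R, hR, hG⟩ := h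
  exact ⟨fun a b => R (f a) (g b), fun t τ a b => hR t τ (f a) (g b),
    fun a b => hG (f a) (g b)⟩

/-- Filtering the first process multiplies the cross spectrum by the transfer matrix. -/
theorem filter_left [Fintype ι] {P : Matrix l ι TransferFunction} {q : VecProcess μ l}
    (h : HasCrossSpectrum x y G) (hq : IsFiltered P x q) :
    HasCrossSpectrum q y fun z => evalMat P z * G z := by
  obtain ⟨R, hR, hG⟩ := h
  obtain ⟨p, hp, hq⟩ := hq
  have hp' : ∀ a b, HasLaurent (fun k => (p a b k : ℂ)) (evalAt (P a b)) := hp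
  have hs : ∀ a b c τ, Summable fun m => p a b (τ - m) * R b c m := fun a b c τ => by
    have := (hp' a b).summable_conv (hG b c) τ
    exact_mod_cast this
  refine ⟨fun a c τ => ∑ b, ∑' m, p a b (τ - m) * R b c m,
    fun t τ a c => ?_, fun a c => ?_⟩
  · have h1 := (hq (t + τ) a).mapL (innerSL ℝ (y t c))
    have h2 : HasSum (fun m => ∑ b, p a b (τ - m) * R b c m)
        (∑ b, ∑' m, p a b (τ - m) * R b c m) := hasSum_sum fun b _ => (hs a b c τ).hasSum
    -- Substituting `k = t + m` in the filter series removes the dependence on `t`, by joint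
    -- stationarity.
    have h3 := (Equiv.addLeft t).hasSum_iff.2 h1
    rw [real_inner_comm]
    refine h3.unique ?_
    refine hasSum_of_forall_eq h2 (fun m => ?_) rfl
    rw [Function.comp_apply, Equiv.coe_addLeft]
    simp only [ map_sum, map_smul, innerSL_apply_apply,
      smul_eq_mul]
    refine Finset.sum_congr rfl fun b _ => ?_
    rw [real_inner_comm, hR, add_sub_add_left_eq_sub]
  · have := HasLaurent.sum (s := Finset.univ) fun b _ => (hp' a b).conv (hG b c)
    have h2 : HasLaurent (fun τ => ((∑ b, ∑' m, p a b (τ - m) * R b c m : ℝ) : ℂ))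
        fun z => ∑ b, evalAt (P a b) z * G z b c := by
      simpa only [Complex.ofReal_sum, Complex.ofReal_tsum, Complex.ofReal_mul] using this
    exact h2

/-- Uniqueness of Laurent coefficients. With its converse below, it makes orthogonality at all pairs
of times equivalent to a vanishing cross spectrum. -/
theorem inner_eq_zero (h : HasCrossSpectrum x y G) (h0 : ∀ z : ℂ, ‖z‖ = 1 → G z = 0)
    (t s : ℤ) (a : ι) (b : κ) : inner ℝ (x t a) (y s b) = 0 := by
  obtain ⟨R, hR, hG⟩ := h
  have h1 := ((hG a b).congr (g' := fun _ => 0) fun z hz => by rw [h0 z hz]; rfl).eq_zero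
  have h2 := hR s (t - s) a b
  rw [add_sub_cancel] at h2
  rw [h2]
  exact Complex.ofReal_eq_zero.1 (congrFun h1 (t - s))

theorem eq_zero_of_inner (h : HasCrossSpectrum x y G)
    (h0 : ∀ t s a b, inner ℝ (x t a) (y s b) = 0) {z : ℂ} (hz : ‖z‖ = 1) : G z = 0 := by
  obtain ⟨R, hR, hG⟩ := h
  ext a b
  refine (hG a b z hz).unique ?_
  have : ∀ τ, R a b τ = 0 := fun τ => by rw [← hR 0 τ, h0]
  simp [this, hasSum_zero]

theorem norm_eq {y : VecProcess μ κ} {G : ℂ → Matrix κ κ ℂ} (h : HasCrossSpectrum y y G)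
    (t : ℤ) (b : κ) : ‖y t b‖ = ‖y 0 b‖ := by
  obtain ⟨R, hR, -⟩ := h
  have h1 := hR t 0 b b
  have h2 := hR 0 0 b b
  rw [add_zero, real_inner_self_eq_norm_sq] at h1 h2
  exact (sq_eq_sq₀ (norm_nonneg _) (norm_nonneg _)).1 (h1.trans h2.symm)

end HasCrossSpectrum

/-! ### Filters -/

theorem IsImpulseResponse.summable_norm {P : TransferFunction} {p : ℤ → ℝ}
    (h : IsImpulseResponse P p) : Summable fun k => ‖p k‖ := by
  have : HasLaurent (fun k => (p k : ℂ)) (evalAt P) := h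
  simpa only [Complex.norm_real] using this.summable_norm

/-- Every transfer matrix can be applied to a process with bounded second moments. -/
theorem exists_isFiltered [Fintype κ] (P : Matrix ι κ TransferFunction) (y : VecProcess μ κ)
    (hy : ∀ t b, ‖y t b‖ = ‖y 0 b‖) : ∃ q, IsFiltered P y q := by
  choose p hp using fun a b => exists_isImpulseResponse (P a b)
  have hs : ∀ t a, Summable fun k : ℤ => ∑ b, p a b (t - k) • y k b := fun t a => by
    refine summable_sum fun b _ => Summable.of_norm ?_
    simp only [norm_smul, hy _ b]
    exact ((Equiv.subLeft t).summable_iff.2 (hp a b).summable_norm).mul_right _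
  exact ⟨fun t a => ∑' k, ∑ b, p a b (t - k) • y k b, p, hp, fun t a => (hs t a).hasSum⟩

theorem IsFiltered.add [Fintype κ] {P P' : Matrix ι κ TransferFunction} {y : VecProcess μ κ}
    {q q' : VecProcess μ ι} (h : IsFiltered P y q) (h' : IsFiltered P' y q') :
    IsFiltered (P + P') y (q + q') := by
  obtain ⟨p, hp, hq⟩ := h
  obtain ⟨p', hp', hq'⟩ := h'
  refine ⟨fun a b k => p a b k + p' a b k, fun a b z hz => ?_, fun t a => ?_⟩
  · have h1 : HasLaurent (fun k => (p a b k : ℂ)) (evalAt (P a b)) := hp a b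
    have h2 : HasLaurent (fun k => (p' a b k : ℂ)) (evalAt (P' a b)) := hp' a b
    have h3 := (h1.add h2) z hz
    have h4 : evalAt ((P + P') a b) z = evalAt (P a b) z + evalAt (P' a b) z :=
      map_add (evalHom z hz) _ _
    rw [h4]
    simpa only [Complex.ofReal_add] using h3
  · have := (hq t a).add (hq' t a)
    simp only [add_smul, Finset.sum_add_distrib]
    exact this

/-- Monomials are transfer functions. -/
theorem exists_isImpulseResponse_single (n : ℤ) (r : ℝ) :
    ∃ f : TransferFunction, IsImpulseResponse f (Pi.single n r) := by
  obtain ⟨f, hf⟩ : ∃ f : TransferFunction, ∀ z : ℂ, ‖z‖ = 1 → evalAt f z = r * z ^ (-n) := by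
    obtain ⟨m, rfl | rfl⟩ := n.eq_nat_or_neg
    · obtain ⟨f, hf⟩ := exists_evalAt_eq_div (Polynomial.C r) (Polynomial.X ^ m) (by
        intro z hz
        have : z ≠ 0 := by rintro rfl; simp at hz
        simp [this])
      exact ⟨f, fun z hz => by rw [hf z hz]; simp [div_eq_mul_inv]⟩
    · obtain ⟨f, hf⟩ := exists_evalAt_eq_div (Polynomial.C r * Polynomial.X ^ m) 1 (by simp)
      exact ⟨f, fun z hz => by rw [hf z hz]; simp⟩
  refine ⟨f, fun z hz => ?_⟩
  rw [hf z hz]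
  refine hasSum_of_forall_eq (HasLaurent.monomial n r z hz) (fun k => ?_) rfl
  by_cases hk : k = n
  · subst hk; simp
  · simp [Pi.single_eq_of_ne hk]

theorem evalAt_zero {z : ℂ} (hz : ‖z‖ = 1) : evalAt 0 z = 0 := map_zero (evalHom z hz)

/-- Shifting one coordinate of a process in time is a filter. -/
theorem exists_isFiltered_single [Fintype κ] [DecidableEq ι] [DecidableEq κ]
    (y : VecProcess μ κ) (n : ℤ) (r : ℝ) (a : ι) (b : κ) :
    ∃ P : Matrix ι κ TransferFunction,
      IsFiltered P y fun t => Pi.single a (r • y (t - n) b) := by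
  obtain ⟨f, hf⟩ := exists_isImpulseResponse_single n r
  refine ⟨Matrix.single a b f, fun a' b' => if a = a' ∧ b = b' then Pi.single n r else 0,
    fun a' b' => ?_, fun t a' => ?_⟩
  · by_cases h : a = a' ∧ b = b'
    · obtain ⟨rfl, rfl⟩ := h
      simpa using hf
    · simp only [if_neg h]
      rw [Matrix.single_apply_of_ne _ _ _ _ _ h]
      intro z hz
      simp [evalAt_zero hz, hasSum_zero]
  · by_cases h : a = a'
    · subst h
      simp only [true_and, ite_apply, Pi.zero_apply, ite_smul, zero_smul, Finset.sum_ite_eq,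
        Finset.mem_univ, if_true, Pi.single_eq_same]
      convert hasSum_single (f := fun k => (Pi.single n r : ℤ → ℝ) (t - k) • y k b) (t - n) ?_ using 1
      · simp
      · intro k hk
        rw [Pi.single_eq_of_ne, zero_smul]
        omega
    · simp [h, hasSum_zero]

/-- Orthogonality to every sample of `y` survives mean square limits of linear combinations. -/
theorem IsFiltered.inner_eq_zero [Fintype κ] {P : Matrix ι κ TransferFunction}
    {y : VecProcess μ κ} {q : VecProcess μ ι} (h : IsFiltered P y q) {v : Lp ℝ 2 μ}
    (hv : ∀ s b, inner ℝ v (y s b) = 0) (t : ℤ) (a : ι) : inner ℝ v (q t a) = 0 := by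
  obtain ⟨p, -, hq⟩ := h
  have h1 := (hq t a).mapL (innerSL ℝ v)
  refine h1.unique ?_
  simp [hv, hasSum_zero]

theorem inner_eq_zero_of_norm_le {E : Type*} [NormedAddCommGroup E] [InnerProductSpace ℝ E]
    {v w : E} (h : ∀ r : ℝ, ‖v‖ ^ 2 ≤ ‖v - r • w‖ ^ 2) : inner ℝ v w = 0 := by
  set c := inner ℝ v w with hc
  set N := ‖w‖ ^ 2 with hN
  have hN0 : 0 ≤ N := by positivity
  have h1 : ∀ r : ℝ, 2 * r * c ≤ r ^ 2 * N := fun r => by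
    have h2 := h r
    rw [norm_sub_sq_real, inner_smul_right, norm_smul, mul_pow, Real.norm_eq_abs, sq_abs] at h2
    linarith
  -- The optimal step would be `c / N`; the `+ 1` covers `w = 0` as well.
  have h2 := h1 (c / (N + 1))
  have h3 : 2 * c ^ 2 * (N + 1) ≤ c ^ 2 * N := by
    have e1 : 2 * (c / (N + 1)) * c = 2 * c ^ 2 * (N + 1) / (N + 1) ^ 2 := by
      field_simp
    have e2 : (c / (N + 1)) ^ 2 * N = c ^ 2 * N / (N + 1) ^ 2 := by
      field_simp
    rw [e1, e2] at h2
    exact (div_le_div_iff_of_pos_right (by positivity)).1 h2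
  have h4 : c ^ 2 = 0 := by nlinarith [sq_nonneg c, mul_nonneg (sq_nonneg c) hN0]
  exact pow_eq_zero_iff (two_ne_zero) |>.1 h4

/-! ### The normal equations -/

/-- A transfer matrix is a Wiener filter if and only if it solves the spectral normal equations. -/
theorem isWienerFilter_iff [Fintype ι] [Fintype κ] {x : VecProcess μ ι} {y : VecProcess μ κ}
    {Gxy : ℂ → Matrix ι κ ℂ} {Gyy : ℂ → Matrix κ κ ℂ} (hxy : HasCrossSpectrum x y Gxy)
    (hyy : HasCrossSpectrum y y Gyy) {W : Matrix ι κ TransferFunction} :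
    IsWienerFilter x y W ↔ ∀ z : ℂ, ‖z‖ = 1 → Gxy z = evalMat W z * Gyy z := by
  classical
  constructor
  · rintro ⟨xhat, hW, hmin⟩ z hz
    have hε := hxy.sub_left (hyy.filter_left hW)
    refine sub_eq_zero.1 (hε.eq_zero_of_inner (fun t s a b => ?_) hz)
    refine inner_eq_zero_of_norm_le fun r => ?_
    -- The competitor adds `r • y s b` to coordinate `a` of the estimate at time `t`; the delay `t -
    -- s` makes it a stationary filter.
    obtain ⟨P, hP⟩ := exists_isFiltered_single (ι := ι) y (t - s) r a b
    have h1 := hmin _ _ (hW.add hP) t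
    by_contra! hlt
    refine absurd h1 (not_le.2 (Finset.sum_lt_sum (fun a' _ => ?_) ⟨a, Finset.mem_univ a, ?_⟩))
    · by_cases ha : a' = a
      · subst ha
        refine le_of_lt ?_
        simpa [sub_sub] using hlt
      · simp [Pi.single_eq_of_ne ha]
    · simpa [sub_sub] using hlt
  · intro h
    obtain ⟨xhat, hW⟩ := exists_isFiltered W y hyy.norm_eq
    refine ⟨xhat, hW, fun P q hq t => Finset.sum_le_sum fun a _ => ?_⟩
    have hε := hxy.sub_left (hyy.filter_left hW)
    have h0 : ∀ s b, inner ℝ (x t a - xhat t a) (y s b) = 0 := fun s b =>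
      hε.inner_eq_zero (fun z hz => sub_eq_zero.2 (h z hz)) t s a b
    -- Pythagoras: the error is orthogonal to the difference of any two filtered versions of `y`.
    have h1 : inner ℝ (x t a - xhat t a) (xhat t a - q t a) = 0 := by
      rw [inner_sub_right, hW.inner_eq_zero h0,
        hq.inner_eq_zero h0, sub_zero]
    have h2 : x t a - q t a = (x t a - xhat t a) + (xhat t a - q t a) := by abel
    rw [h2, norm_add_sq_real, h1]
    nlinarith [sq_nonneg ‖xhat t a - q t a‖]

end Spectra

/-! ### Wiener filters from the inverse spectrum -/

section InverseSpectrum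

theorem submatrix_mul_of_bijective {n ι κ R : Type*} [Fintype n] [Fintype ι] [Fintype κ]
    [CommRing R] (A B : Matrix n n R) {f : ι → n} {g : κ → n}
    (h : Function.Bijective (Sum.elim f g)) :
    (A * B).submatrix f g =
      A.submatrix f f * B.submatrix f g + A.submatrix f g * B.submatrix g g := by
  ext a b
  simp only [Matrix.submatrix_apply, Matrix.add_apply, Matrix.mul_apply]
  rw [← h.sum_comp fun c => A (f a) c * B c (g b), Fintype.sum_sum_type]
  rfl

/-- The normal equations in terms of the inverse of the covariance matrix. -/
theorem eq_mul_iff_of_mul_eq_one {n ι κ : Type*} [Fintype n] [DecidableEq n] [Fintype ι]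
    [Fintype κ] {K Φ : Matrix n n ℂ} (hΦ : Φ.PosDef) (hK : K * Φ = 1) {f : ι → n} {g : κ → n}
    (h : Function.Bijective (Sum.elim f g)) (W : Matrix ι κ ℂ) :
    Φ.submatrix f g = W * Φ.submatrix g g ↔ K.submatrix f f * W = -K.submatrix f g := by
  classical
  have hf : Function.Injective f := fun a b hab => Sum.inl_injective (h.1 hab)
  have hg : Function.Injective g := fun a b hab => Sum.inr_injective (h.1 hab)
  have hKpos : K.PosDef := by
    rw [← Matrix.inv_eq_left_inv hK]
    exact hΦ.inv
  have hK11 : IsUnit (K.submatrix f f) := (hKpos.submatrix hf).isUnit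
  have hΦ22 : IsUnit (Φ.submatrix g g) := (hΦ.submatrix hg).isUnit
  -- The off-diagonal block of `K * Φ = 1` links the two forms of the normal equations.
  have h0 : K.submatrix f f * Φ.submatrix f g + K.submatrix f g * Φ.submatrix g g = 0 := by
    rw [← submatrix_mul_of_bijective K Φ h, hK]
    ext a b
    have hne : f a ≠ g b := fun hab => Sum.inl_ne_inr (h.1 hab)
    simp [hne]
  obtain ⟨L, hL⟩ := hK11.exists_left_inv
  obtain ⟨N, hN⟩ := hΦ22.exists_right_inv
  rw [add_eq_zero_iff_eq_neg] at h0
  constructor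
  · intro h1
    have h2 : K.submatrix f f * W * Φ.submatrix g g * N =
        -K.submatrix f g * Φ.submatrix g g * N := by
      rw [Matrix.mul_assoc (K.submatrix f f), ← h1, h0, ← Matrix.neg_mul]
    rwa [Matrix.mul_assoc _ _ N, Matrix.mul_assoc _ _ N, hN, Matrix.mul_one, Matrix.mul_one] at h2
  · intro h1
    have h2 : L * (K.submatrix f f * Φ.submatrix f g) =
        L * (K.submatrix f f * (W * Φ.submatrix g g)) := by
      rw [h0, ← Matrix.mul_assoc (K.submatrix f f), h1, Matrix.neg_mul]
    rwa [← Matrix.mul_assoc, ← Matrix.mul_assoc, hL, Matrix.one_mul, Matrix.one_mul] at h2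

/-! ### Wiener filters of one node from all the others -/

variable {V : Type*} {d : V → ℕ}
variable {Ω : Type*} [MeasurableSpace Ω] {μ : Measure Ω}

theorem bijective_elim_coord [DecidableEq V] (v : V) {S : Finset V} (hS : ∀ w, w ∈ S ↔ w ≠ v) :
    Function.Bijective (Sum.elim (fun a : Fin (d v) => (⟨v, a⟩ : Coord d))
      (fun b : SubCoord d S => (⟨b.1, b.2⟩ : Coord d))) := by
  constructor
  · rintro (a | ⟨⟨w, hw⟩, a⟩) (b | ⟨⟨w', hw'⟩, b⟩) hab
    · simpa using hab
    · simp only [Sum.elim_inl, Sum.elim_inr, Sigma.mk.injEq] at hab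
      exact absurd hab.1.symm ((hS w').1 hw')
    · simp only [Sum.elim_inl, Sum.elim_inr, Sigma.mk.injEq] at hab
      exact absurd hab.1 ((hS w).1 hw)
    · simp only [Sum.elim_inr, Sigma.mk.injEq] at hab
      obtain ⟨rfl, hab⟩ := hab
      rw [eq_of_heq hab]
  · rintro ⟨w, a⟩
    by_cases hw : w = v
    · subst hw
      exact ⟨Sum.inl a, rfl⟩
    · exact ⟨Sum.inr ⟨⟨w, (hS w).2 hw⟩, a⟩, rfl⟩

variable {y : VecProcess μ (Coord d)} {Φ : ℂ → Matrix (Coord d) (Coord d) ℂ}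
  {K : Matrix (Coord d) (Coord d) TransferFunction}

theorem isUnit_block [Fintype V] [DecidableEq V] (hpos : ∀ z : ℂ, ‖z‖ = 1 → (Φ z).PosDef)
    (hK : ∀ z : ℂ, ‖z‖ = 1 → evalMat K z * Φ z = 1) (v : V) : IsUnit (block K v v) := by
  refine isUnit_of_isUnit_evalMat fun z hz => ?_
  have h1 : (evalMat K z).PosDef := by
    rw [← Matrix.inv_eq_left_inv (hK z hz)]
    exact (hpos z hz).inv
  exact (h1.submatrix (sigma_mk_injective (i := v))).isUnit

theorem isWienerFilter_node_iff [Fintype V] [DecidableEq V]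
    (hy : HasCrossSpectrum y y Φ)
    (hpos : ∀ z : ℂ, ‖z‖ = 1 → (Φ z).PosDef)
    (hK : ∀ z : ℂ, ‖z‖ = 1 → evalMat K z * Φ z = 1) (v : V) {S : Finset V}
    (hS : ∀ w, w ∈ S ↔ w ≠ v) (W : Matrix (Fin (d v)) (SubCoord d S) TransferFunction) :
    IsWienerFilter (nodeProcess y v) (subProcess y S) W ↔
      block K v v * W = -K.submatrix (fun a => ⟨v, a⟩) (fun b => ⟨b.1, b.2⟩) := by
  have hW : IsWienerFilter (nodeProcess y v) (subProcess y S) W ↔ _ :=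
    isWienerFilter_iff (hy.submatrix (fun a => ⟨v, a⟩) fun b : SubCoord d S => ⟨b.1, b.2⟩)
      (hy.submatrix (fun b : SubCoord d S => ⟨b.1, b.2⟩) fun b : SubCoord d S => ⟨b.1, b.2⟩)
  rw [hW]
  have key := fun z hz =>
    eq_mul_iff_of_mul_eq_one (hpos z hz) (hK z hz) (bijective_elim_coord v hS) (evalMat W z)
  have hneg : ∀ z : ℂ, ‖z‖ = 1 → evalMat (-K.submatrix (fun a : Fin (d v) => (⟨v, a⟩ : Coord d))
      (fun b : SubCoord d S => (⟨b.1, b.2⟩ : Coord d))) z =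
      -(evalMat K z).submatrix (fun a => ⟨v, a⟩) (fun b => ⟨b.1, b.2⟩) := fun z hz => by
    ext a b
    exact map_neg (evalHom z hz) _
  constructor
  · intro h
    refine ext_evalMat fun z hz => ?_
    rw [evalMat_mul _ _ hz, hneg z hz]
    exact (key z hz).1 (h z hz)
  · intro h z hz
    refine (key z hz).2 ?_
    rw [← hneg z hz, ← h, evalMat_mul _ _ hz]
    rfl

theorem existsUnique_isWienerFilter_node [Fintype V] [DecidableEq V]
    (hy : HasCrossSpectrum y y Φ)
    (hpos : ∀ z : ℂ, ‖z‖ = 1 → (Φ z).PosDef)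
    (hK : ∀ z : ℂ, ‖z‖ = 1 → evalMat K z * Φ z = 1) (v : V) {S : Finset V}
    (hS : ∀ w, w ∈ S ↔ w ≠ v) :
    ∃! W, IsWienerFilter (nodeProcess y v) (subProcess y S) W := by
  simp only [isWienerFilter_node_iff hy hpos hK v hS]
  obtain ⟨L, hL, hL'⟩ : ∃ L, block K v v * L = 1 ∧ L * block K v v = 1 := by
    obtain ⟨L, hL⟩ := (isUnit_block hpos hK v).exists_right_inv
    exact ⟨L, hL, mul_eq_one_comm.1 hL⟩
  refine ⟨L * -K.submatrix (fun a => ⟨v, a⟩) (fun b => ⟨b.1, b.2⟩), ?_, fun W hW => ?_⟩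
  · beta_reduce
    rw [← Matrix.mul_assoc, hL, Matrix.one_mul]
  · rw [← hW, ← Matrix.mul_assoc, hL', Matrix.one_mul]

theorem IsWienerFilter.block_mul_component [Fintype V] [DecidableEq V]
    (hy : HasCrossSpectrum y y Φ)
    (hpos : ∀ z : ℂ, ‖z‖ = 1 → (Φ z).PosDef)
    (hK : ∀ z : ℂ, ‖z‖ = 1 → evalMat K z * Φ z = 1) {v : V} {S : Finset V}
    (hS : ∀ w, w ∈ S ↔ w ≠ v) {W : Matrix (Fin (d v)) (SubCoord d S) TransferFunction}
    (hW : IsWienerFilter (nodeProcess y v) (subProcess y S) W) (w : V) (hw : w ∈ S) :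
    block K v v * component W w hw = -block K v w := by
  have h := (isWienerFilter_node_iff hy hpos hK v hS W).1 hW
  ext1 a b
  exact congrFun (congrFun h a) ⟨⟨w, hw⟩, b⟩

/-! ### The inverse spectrum of a linear dynamic influence model -/

theorem block_sub (A B : Matrix (Coord d) (Coord d) TransferFunction) (w v : V) :
    block (A - B) w v = block A w v - block B w v := rfl

theorem block_mul [Fintype V] (A B : Matrix (Coord d) (Coord d) TransferFunction) (w v : V) :
    block (A * B) w v = ∑ u, block A w u * block B u v := by
  ext1 a b
  simp only [block, Matrix.of_apply, Matrix.mul_apply, Matrix.sum_apply, Fintype.sum_sigma]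

theorem block_one_self [DecidableEq V] (v : V) :
    block (1 : Matrix (Coord d) (Coord d) TransferFunction) v v = 1 := by
  ext1 a b
  simp [block, Matrix.one_apply]

theorem block_one_of_ne [DecidableEq V] {w v : V} (h : w ≠ v) :
    block (1 : Matrix (Coord d) (Coord d) TransferFunction) w v = 0 := by
  ext1 a b
  simp [block, h]

theorem block_mul_blockDiagonal' [Fintype V] [DecidableEq V]
    (A : Matrix (Coord d) (Coord d) TransferFunction)
    (S : ∀ v, Matrix (Fin (d v)) (Fin (d v)) TransferFunction) (w v : V) :
    block (A * Matrix.blockDiagonal' S) w v = block A w v * S v := by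
  rw [block_mul, Finset.sum_eq_single v]
  · congr 1
    ext1 a b
    exact Matrix.blockDiagonal'_apply_eq S v a b
  · intro u _ hu
    have : block (Matrix.blockDiagonal' S) u v = 0 := by
      ext1 a b
      exact Matrix.blockDiagonal'_apply_ne S a b hu
    rw [this, Matrix.mul_zero]
  · simp

theorem block_eq_zero_of_conjTranspose {Q Q' : Matrix (Coord d) (Coord d) TransferFunction}
    (h : ∀ z : ℂ, ‖z‖ = 1 → evalMat Q' z = (evalMat Q z).conjTranspose) {w v : V}
    (h0 : block Q w v = 0) : block Q' v w = 0 := by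
  ext1 a b
  refine ext_unitCircle fun z hz => ?_
  have h1 := congrFun (congrFun (h z hz) ⟨v, a⟩) ⟨w, b⟩
  have h2 : Q ⟨w, b⟩ ⟨v, a⟩ = 0 := congrFun (congrFun h0 b) a
  rw [evalMat_apply, Matrix.conjTranspose_apply, evalMat_apply, h2, evalAt_zero hz, star_zero] at h1
  exact h1.trans (evalAt_zero hz).symm

/-- If no node has a self-loop and the output spectrum is positive definite, then the noise spectrum
is block diagonal and invertible and `Φ⁻¹ = (1 - Q)ᴴ S (1 - Q)` with `S` its inverse. -/
theorem IsLDIM.exists_inverse_spectrum [Fintype V] [DecidableEq V]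
    {Q : Matrix (Coord d) (Coord d) TransferFunction}
    {e : VecProcess μ (Coord d)} (hL : IsLDIM Q e y) (hQ : ∀ v, block Q v v = 0)
    (hΦ : HasPSD y Φ) (hpos : ∀ z : ℂ, ‖z‖ = 1 → (Φ z).PosDef) :
    ∃ (S : ∀ v, Matrix (Fin (d v)) (Fin (d v)) TransferFunction)
      (Q' : Matrix (Coord d) (Coord d) TransferFunction),
      (∀ v, IsUnit (S v)) ∧
      (∀ z : ℂ, ‖z‖ = 1 → evalMat Q' z = (evalMat Q z).conjTranspose) ∧
      ∀ z : ℂ, ‖z‖ = 1 →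
        evalMat ((1 - Q') * Matrix.blockDiagonal' S * (1 - Q)) z * Φ z = 1 := by
  obtain ⟨m, u, P, hu, huΦ, -, hPdiag, he⟩ := hL.input
  obtain ⟨P', hP'⟩ := exists_evalMat_eq_conjTranspose P
  obtain ⟨Q', hQ'⟩ := exists_evalMat_eq_conjTranspose Q
  have hy := hL.wss.hasCrossSpectrum hΦ
  -- The noise spectrum is computed twice: as `P Pᴴ`, hence block diagonal, and from `e = y - Q y`
  -- as `(1 - Q) Φ (1 - Q)ᴴ`.
  have hE1 := ((hu.hasCrossSpectrum huΦ).filter_left he).symm.filter_left he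
  have hey : HasCrossSpectrum e y fun z => Φ z - evalMat Q z * Φ z := by
    have := hy.sub_left (hy.filter_left hL.dynamics)
    rwa [sub_sub_cancel] at this
  have hE2 : HasCrossSpectrum e e fun z =>
      (Φ z - evalMat Q z * Φ z).conjTranspose -
        evalMat Q z * (Φ z - evalMat Q z * Φ z).conjTranspose := by
    have := hey.symm.sub_left (hey.symm.filter_left hL.dynamics)
    rwa [sub_sub_cancel] at this
  have hD : ∀ z : ℂ, ‖z‖ = 1 → evalMat (1 - Q) z = 1 - evalMat Q z := fun z hz => by
    rw [evalMat_sub _ _ hz, evalMat_one hz]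
  have hE : ∀ z : ℂ, ‖z‖ = 1 → evalMat (P * P') z =
      evalMat (1 - Q) z * Φ z * (evalMat (1 - Q) z).conjTranspose := fun z hz => by
    have h1 := hE1.unique hE2 hz
    have hH : (Φ z).conjTranspose = Φ z := (hpos z hz).isHermitian
    simp only [Matrix.mul_one] at h1
    rw [evalMat_mul _ _ hz, hP' z hz, h1, hD z hz]
    simp only [Matrix.conjTranspose_sub, Matrix.conjTranspose_mul, Matrix.conjTranspose_one, hH]
    noncomm_ring
  have hP'diag : ∀ (a : Coord m) (b : Coord d), a.1 ≠ b.1 → P' a b = 0 := fun a b hab => by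
    refine ext_unitCircle fun z hz => ?_
    have h1 := congrFun (congrFun (hP' z hz) a) b
    rw [evalMat_apply, Matrix.conjTranspose_apply, evalMat_apply, hPdiag b a (Ne.symm hab),
      evalAt_zero hz, star_zero] at h1
    exact h1.trans (evalAt_zero hz).symm
  have hEdiag : P * P' = Matrix.blockDiagonal' fun v => block (P * P') v v := by
    ext1 ⟨v, a⟩ ⟨w, b⟩
    by_cases hvw : v = w
    · subst hvw
      rw [Matrix.blockDiagonal'_apply_eq]
      rfl
    · rw [Matrix.blockDiagonal'_apply_ne _ _ _ hvw, Matrix.mul_apply]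
      refine Finset.sum_eq_zero fun c _ => ?_
      by_cases hc : v = c.1
      · rw [hP'diag c ⟨w, b⟩ (fun h => hvw (hc.trans h)), mul_zero]
      · rw [hPdiag ⟨v, a⟩ c hc, zero_mul]
  have hunit : ∀ v, IsUnit (block (P * P') v v) := fun v => by
    refine isUnit_of_isUnit_evalMat fun z hz => ?_
    let f : Fin (d v) → Coord d := fun a => ⟨v, a⟩
    -- Without self-loops, block row `v` of `1 - Q` contains an identity block, so it has full row
    -- rank and `L Φ Lᴴ` is positive definite.
    set L := (evalMat (1 - Q) z).submatrix f id
    have h1 : evalMat (block (P * P') v v) z = L * Φ z * L.conjTranspose := by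
      have := congrArg (fun M => M.submatrix f f) (hE z hz)
      exact this
    rw [h1]
    refine ((hpos z hz).mul_mul_conjTranspose_same fun r s hrs => ?_).isUnit
    have hcol : ∀ (t : Fin (d v) → ℂ) (b : Fin (d v)), Matrix.vecMul t L ⟨v, b⟩ = t b := by
      intro t b
      have h2 : ∀ a, L a ⟨v, b⟩ = (1 : Matrix (Fin (d v)) (Fin (d v)) ℂ) a b := fun a => by
        have h3 : evalMat (block (1 - Q) v v) z = 1 := by
          rw [block_sub, hQ, sub_zero, block_one_self, evalMat_one hz]
        exact congrFun (congrFun h3 a) b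
      have h4 : Matrix.vecMul t L ⟨v, b⟩ = Matrix.vecMul t 1 b := by
        simp only [Matrix.vecMul, dotProduct, h2]
      rw [h4, Matrix.vecMul_one]
    funext b
    rw [← hcol r b, ← hcol s b]
    exact congrFun hrs _
  choose S hS using fun v => (hunit v).exists_right_inv
  refine ⟨S, Q', fun v => IsUnit.of_mul_eq_one _ (mul_eq_one_comm.1 (hS v)), hQ', fun z hz => ?_⟩
  have hES : P * P' * Matrix.blockDiagonal' S = 1 := by
    rw [hEdiag, ← Matrix.blockDiagonal'_mul]
    simp only [hS]
    exact Matrix.blockDiagonal'_one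
  have hESz : evalMat (P * P') z * evalMat (Matrix.blockDiagonal' S) z = 1 := by
    rw [← evalMat_mul _ _ hz, hES, evalMat_one hz]
  have hD' : evalMat (1 - Q') z = (evalMat (1 - Q) z).conjTranspose := by
    rw [hD z hz, evalMat_sub _ _ hz, evalMat_one hz, hQ' z hz, Matrix.conjTranspose_sub,
      Matrix.conjTranspose_one]
  -- One-sided inverses of square matrices are two-sided, so the factor `1 - Q` can be moved
  -- cyclically without knowing beforehand that it is invertible.
  rw [evalMat_mul _ _ hz, evalMat_mul _ _ hz, hD', mul_eq_one_comm]
  rw [hE z hz, Matrix.mul_assoc, Matrix.mul_assoc, mul_eq_one_comm] at hESz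
  simpa only [Matrix.mul_assoc] using hESz

end InverseSpectrum

/-! ### The loop -/

/-- The algebra of the revolving door: `K`-blocks of the loop, expressed by the edge transfer
matrices `Q`, their conjugates `R` and the inverse noise spectra `S`, determine `Qji` from the
Wiener filter components. -/
theorem revolving_door_algebra {F ι κ l : Type*} [CommRing F] [Fintype ι] [DecidableEq ι]
    [Fintype κ] [DecidableEq κ] [Fintype l] [DecidableEq l]
    {Si : Matrix ι ι F} {Sj : Matrix κ κ F} {Sk : Matrix l l F}
    {Qji : Matrix κ ι F} {Qkj : Matrix l κ F} {Qik : Matrix ι l F}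
    {Rij : Matrix ι κ F} {Rjk : Matrix κ l F} {Rki : Matrix l ι F}
    {Wji : Matrix κ ι F} {Wjk : Matrix κ l F} {Wkj : Matrix l κ F}
    {Wki : Matrix l ι F} {Wik : Matrix ι l F} {Wij : Matrix ι κ F}
    (hSi : IsUnit Si) (hSj : IsUnit Sj) (hSk : IsUnit Sk)
    (hKk : IsUnit (Sk + Rki * Si * Qik))
    (hji : (Sj + Rjk * Sk * Qkj) * Wji = Sj * Qji)
    (hjk : (Sj + Rjk * Sk * Qkj) * Wjk = Rjk * Sk)
    (hkj : (Sk + Rki * Si * Qik) * Wkj = Sk * Qkj)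
    (hki : (Sk + Rki * Si * Qik) * Wki = Rki * Si)
    (hik : (Si + Rij * Sj * Qji) * Wik = Si * Qik)
    (hij : (Si + Rij * Sj * Qji) * Wij = Rij * Sj) :
    let A := 1 - Wij * Qji - Wik * Wki
    let B := 1 - Wjk * Wkj - Wjk * Wki * A⁻¹ * (Wik * Wkj)
    IsUnit A ∧ IsUnit B ∧ Qji = B⁻¹ * Wji := by
  intro A B
  obtain ⟨Si', hSi'⟩ := hSi.exists_right_inv
  obtain ⟨Sj', hSj'⟩ := hSj.exists_left_inv
  obtain ⟨Sk', hSk'⟩ := hSk.exists_right_inv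
  have hSk'' := mul_eq_one_comm.1 hSk'
  obtain ⟨Lk, hLk⟩ := hKk.exists_left_inv
  set Ki := Si + Rij * Sj * Qji with hKi
  -- Woodbury: `Ki * A = Si - Si Qik (Sk + Rki Si Qik)⁻¹ Rki Si`, whose inverse is `Si⁻¹ + Qik Sk⁻¹
  -- Rki`.
  set T := Si' + Qik * Sk' * Rki with hT
  have hWT : Wki * T = Sk' * Rki := by
    have h1 : (Sk + Rki * Si * Qik) * (Wki * T) = (Sk + Rki * Si * Qik) * (Sk' * Rki) := by
      rw [← Matrix.mul_assoc, hki, hT, Matrix.mul_add, Matrix.add_mul, Matrix.mul_assoc Rki Si Si',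
        hSi', ← Matrix.mul_assoc Sk, hSk', Matrix.one_mul, Matrix.mul_one]
      simp only [Matrix.mul_assoc]
    have h2 := congrArg (Lk * ·) h1
    simpa only [← Matrix.mul_assoc Lk, hLk, Matrix.one_mul] using h2
  have hKA : Ki * A = Si - Si * Qik * Wki := by
    simp only [A]
    rw [Matrix.mul_sub, Matrix.mul_sub, ← Matrix.mul_assoc, ← Matrix.mul_assoc, hij, hik, hKi,
      Matrix.mul_one, add_sub_cancel_right]
  have hKAT : Ki * A * T = 1 := by
    rw [hKA, Matrix.sub_mul, Matrix.mul_assoc _ Wki T, hWT, hT, Matrix.mul_add, hSi']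
    simp only [Matrix.mul_assoc, add_sub_cancel_right]
  have hAT : A * (T * Ki) = 1 := by
    rw [Matrix.mul_assoc, mul_eq_one_comm] at hKAT
    rw [← Matrix.mul_assoc, hKAT]
  have hAinv : A⁻¹ = T * Ki := Matrix.inv_eq_right_inv hAT
  -- The equation for `Wkj` reads `Qkj = Wkj + Sk⁻¹ Rki Si Qik Wkj`; the inner inverse expresses the
  -- last term through filter components.
  have hQkj : Wkj + Wki * A⁻¹ * (Wik * Wkj) = Qkj := by
    have h1 : Wki * A⁻¹ * (Wik * Wkj) = Sk' * (Rki * Si * Qik * Wkj) := by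
      rw [hAinv, ← Matrix.mul_assoc Wki, hWT, Matrix.mul_assoc _ Ki, ← Matrix.mul_assoc Ki, hik]
      simp only [Matrix.mul_assoc]
    have h2 : Sk' * ((Sk + Rki * Si * Qik) * Wkj) = Qkj := by
      rw [hkj, ← Matrix.mul_assoc, hSk'', Matrix.one_mul]
    rw [h1, ← h2, Matrix.add_mul, Matrix.mul_add, ← Matrix.mul_assoc Sk' Sk, hSk'', Matrix.one_mul]
  have hB : B = 1 - Wjk * Qkj := by
    simp only [B]
    rw [← hQkj, Matrix.mul_add, sub_sub]
    simp only [Matrix.mul_assoc]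
  have hKB : (Sj + Rjk * Sk * Qkj) * B = Sj := by
    rw [hB, Matrix.mul_sub, ← Matrix.mul_assoc, hjk, Matrix.mul_one, add_sub_cancel_right]
  have hBinv : Sj' * (Sj + Rjk * Sk * Qkj) * B = 1 := by
    rw [Matrix.mul_assoc, hKB, hSj']
  refine ⟨IsUnit.of_mul_eq_one _ hAT, IsUnit.of_mul_eq_one _ (mul_eq_one_comm.1 hBinv), ?_⟩
  rw [Matrix.inv_eq_left_inv hBinv, Matrix.mul_assoc, hji, ← Matrix.mul_assoc, hSj', Matrix.one_mul]

/-- The successor of a node in the loop `i → j → k → i`. -/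
def Node.next : Node → Node
  | .i => .j
  | .j => .k
  | .k => .i
  | .s => .s

theorem Node.next_ne {v : Node} (hv : v ≠ .s) : v.next ≠ v := by
  cases v <;> simp_all [Node.next]

/-! ### Blocks of the inverse spectrum for the loop graph -/

section LoopBlocks

variable {d : Node → ℕ} {Q Q' : Matrix (Coord d) (Coord d) TransferFunction}

theorem IsGraphicalRepresentation.block_self (hG : IsGraphicalRepresentation loopGraph Q)
    (v : Node) : block Q v v = 0 :=
  hG v v (by cases v <;> simp [loopGraph])

theorem IsGraphicalRepresentation.block_eq_zero (hG : IsGraphicalRepresentation loopGraph Q)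
    {v w : Node} (hv : v ≠ .s) (hw : w ≠ v.next) : block Q w v = 0 :=
  hG v w (by cases v <;> cases w <;> simp_all [loopGraph, Node.next])

/-- A loop node and its successor are the only nodes that contribute to the column of that node in
`(1 - Q)ᴴ S (1 - Q)`. -/
theorem IsGraphicalRepresentation.block_inverse_spectrum
    (hG : IsGraphicalRepresentation loopGraph Q)
    (S : ∀ v, Matrix (Fin (d v)) (Fin (d v)) TransferFunction) (w : Node) {v : Node}
    (hv : v ≠ .s) :
    block ((1 - Q') * Matrix.blockDiagonal' S * (1 - Q)) w v =
      block (1 - Q') w v * S v - block (1 - Q') w v.next * S v.next * block Q v.next v := by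
  rw [block_mul, ← Finset.sum_subset (Finset.subset_univ {v, v.next}),
    Finset.sum_pair (Node.next_ne hv).symm]
  · rw [block_mul_blockDiagonal', block_mul_blockDiagonal', block_sub 1 Q, block_sub 1 Q,
      block_one_self, hG.block_self, block_one_of_ne (Node.next_ne hv), sub_zero, zero_sub,
      Matrix.mul_one, Matrix.mul_neg, ← sub_eq_add_neg]
  · intro u _ hu
    simp only [Finset.mem_insert, Finset.mem_singleton, not_or] at hu
    rw [block_sub 1 Q, block_one_of_ne hu.1, hG.block_eq_zero hv hu.2, sub_zero, Matrix.mul_zero]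

theorem IsGraphicalRepresentation.block_inverse_spectrum_self
    (hG : IsGraphicalRepresentation loopGraph Q)
    (hQ' : ∀ z : ℂ, ‖z‖ = 1 → evalMat Q' z = (evalMat Q z).conjTranspose)
    (S : ∀ v, Matrix (Fin (d v)) (Fin (d v)) TransferFunction) {v : Node} (hv : v ≠ .s) :
    block ((1 - Q') * Matrix.blockDiagonal' S * (1 - Q)) v v =
      S v + block Q' v v.next * S v.next * block Q v.next v := by
  rw [hG.block_inverse_spectrum S v hv, block_sub, block_sub, block_one_self,
    block_one_of_ne (Node.next_ne hv).symm,
    block_eq_zero_of_conjTranspose hQ' (hG.block_self v), sub_zero, zero_sub, Matrix.one_mul,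
    Matrix.neg_mul, Matrix.neg_mul, sub_neg_eq_add]

theorem IsGraphicalRepresentation.block_inverse_spectrum_next_left
    (hG : IsGraphicalRepresentation loopGraph Q)
    (hQ' : ∀ z : ℂ, ‖z‖ = 1 → evalMat Q' z = (evalMat Q z).conjTranspose)
    (S : ∀ v, Matrix (Fin (d v)) (Fin (d v)) TransferFunction) {v : Node} (hv : v ≠ .s) :
    block ((1 - Q') * Matrix.blockDiagonal' S * (1 - Q)) v.next v =
      -(S v.next * block Q v.next v) := by
  have h : block Q v v.next = 0 :=
    hG v.next v (by cases v <;> simp_all [loopGraph, Node.next])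
  rw [hG.block_inverse_spectrum S v.next hv, block_sub, block_sub, block_one_self,
    block_one_of_ne (Node.next_ne hv), block_eq_zero_of_conjTranspose hQ' (hG.block_self v.next),
    block_eq_zero_of_conjTranspose hQ' h, sub_zero, sub_zero, Matrix.zero_mul, zero_sub,
    Matrix.one_mul]

theorem IsGraphicalRepresentation.block_inverse_spectrum_next_right
    (hG : IsGraphicalRepresentation loopGraph Q)
    (hQ' : ∀ z : ℂ, ‖z‖ = 1 → evalMat Q' z = (evalMat Q z).conjTranspose)
    (S : ∀ v, Matrix (Fin (d v)) (Fin (d v)) TransferFunction) {v : Node} (hv : v ≠ .s) :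
    block ((1 - Q') * Matrix.blockDiagonal' S * (1 - Q)) v v.next =
      -(block Q' v v.next * S v.next) := by
  have hv' : v.next ≠ .s := by cases v <;> simp_all [Node.next]
  have h : block Q v.next.next v = 0 :=
    hG v v.next.next (by cases v <;> simp_all [loopGraph, Node.next])
  have hne : v ≠ v.next.next := by cases v <;> simp_all [Node.next]
  rw [hG.block_inverse_spectrum S v hv', block_sub, block_sub,
    block_one_of_ne (Node.next_ne hv).symm, block_one_of_ne hne,
    block_eq_zero_of_conjTranspose hQ' h, sub_zero, Matrix.zero_mul, Matrix.zero_mul, sub_zero,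
    zero_sub, Matrix.neg_mul]

end LoopBlocks

end LDIM

end

/-! ### The revolving door criterion -/

open LDIM in
theorem mainTheorem5 {Ω : Type*} [MeasurableSpace Ω] (μ : Measure Ω) [IsProbabilityMeasure μ]
    (d : Node → ℕ)
    (Q : Matrix (Coord d) (Coord d) TransferFunction)
    (e y : VecProcess μ (Coord d))
    (hLDIM : IsLDIM Q e y)
    (hG : IsGraphicalRepresentation loopGraph Q)
    (Φ : ℂ → Matrix (Coord d) (Coord d) ℂ)
    (hΦ : HasPSD y Φ)
    (hpos : ∀ z : ℂ, ‖z‖ = 1 → (Φ z).PosDef) :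
    -- the three Wiener filters exist and are unique
    (∃! W, IsWienerFilter (nodeProcess y .j) (subProcess y {.i, .k, .s}) W) ∧
    (∃! W, IsWienerFilter (nodeProcess y .k) (subProcess y {.j, .i, .s}) W) ∧
    (∃! W, IsWienerFilter (nodeProcess y .i) (subProcess y {.k, .j, .s}) W) ∧
    ∀ (Wj : Matrix (Fin (d .j)) (SubCoord d {.i, .k, .s}) TransferFunction)
      (Wk : Matrix (Fin (d .k)) (SubCoord d {.j, .i, .s}) TransferFunction)
      (Wi : Matrix (Fin (d .i)) (SubCoord d {.k, .j, .s}) TransferFunction),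
      IsWienerFilter (nodeProcess y .j) (subProcess y {.i, .k, .s}) Wj →
      IsWienerFilter (nodeProcess y .k) (subProcess y {.j, .i, .s}) Wk →
      IsWienerFilter (nodeProcess y .i) (subProcess y {.k, .j, .s}) Wi →
      let Wji := component Wj .i (by decide)
      let Wjk := component Wj .k (by decide)
      let Wkj := component Wk .j (by decide)
      let Wki := component Wk .i (by decide)
      let Wik := component Wi .k (by decide)
      let Wij := component Wi .j (by decide)
      let A := 1 - Wij * block Q .j .i - Wik * Wki
      let B := 1 - Wjk * Wkj - Wjk * Wki * A⁻¹ * (Wik * Wkj)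
      -- both inverses exist as matrices of transfer functions without poles on the unit circle
      IsUnit A ∧ IsUnit B ∧ block Q .j .i = B⁻¹ * Wji := by
  obtain ⟨S, Q', hS, hQ', hK⟩ := hLDIM.exists_inverse_spectrum hG.block_self hΦ hpos
  have hy := hLDIM.wss.hasCrossSpectrum hΦ
  have hi : Node.i ≠ .s := by decide
  have hj : Node.j ≠ .s := by decide
  have hk : Node.k ≠ .s := by decide
  have hSj : ∀ w, w ∈ ({.i, .k, .s} : Finset Node) ↔ w ≠ .j := by decide
  have hSk : ∀ w, w ∈ ({.j, .i, .s} : Finset Node) ↔ w ≠ .k := by decide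
  have hSi : ∀ w, w ∈ ({.k, .j, .s} : Finset Node) ↔ w ≠ .i := by decide
  refine ⟨existsUnique_isWienerFilter_node hy hpos hK _ hSj,
    existsUnique_isWienerFilter_node hy hpos hK _ hSk,
    existsUnique_isWienerFilter_node hy hpos hK _ hSi, ?_⟩
  intro Wj Wk Wi hWj hWk hWi
  have ej := hWj.block_mul_component hy hpos hK hSj
  have ek := hWk.block_mul_component hy hpos hK hSk
  have ei := hWi.block_mul_component hy hpos hK hSi
  have uk := isUnit_block hpos hK .k
  rw [hG.block_inverse_spectrum_self hQ' S hj] at ej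
  rw [hG.block_inverse_spectrum_self hQ' S hk] at ek uk
  rw [hG.block_inverse_spectrum_self hQ' S hi] at ei
  -- In each of the six equations `K_vv W_vw = -K_vw`, one of `v`, `w` is the successor of the
  -- other, which decides between the `next_left` and `next_right` formulas.
  refine revolving_door_algebra (Qkj := block Q .k .j) (Qik := block Q .i .k)
    (Rij := block Q' .i .j) (Rjk := block Q' .j .k) (Rki := block Q' .k .i) (hS .i)
    (hS .j) (hS .k) uk ?_ ?_ ?_ ?_ ?_ ?_
  · exact (ej .i (by decide)).trans
      (neg_eq_iff_eq_neg.2 (hG.block_inverse_spectrum_next_left hQ' S hi))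
  · exact (ej .k (by decide)).trans
      (neg_eq_iff_eq_neg.2 (hG.block_inverse_spectrum_next_right hQ' S hj))
  · exact (ek .j (by decide)).trans
      (neg_eq_iff_eq_neg.2 (hG.block_inverse_spectrum_next_left hQ' S hj))
  · exact (ek .i (by decide)).trans
      (neg_eq_iff_eq_neg.2 (hG.block_inverse_spectrum_next_right hQ' S hk))
  · exact (ei .k (by decide)).trans
      (neg_eq_iff_eq_neg.2 (hG.block_inverse_spectrum_next_left hQ' S hk))
  · exact (ei .j (by decide)).trans
      (neg_eq_iff_eq_neg.2 (hG.block_inverse_spectrum_next_right hQ' S hi))
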